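/- Let $n\ge 0$ be an integer. Let $B$ be an operator in Rahman's class $\mathcal B_n$, that is, an operator on the complex polynomials of degree at most $n$ of the form $$B[P](z)=\lambda_0P(z)+\lambda_1\Big(\frac{nz}{2}\Big)\frac{P'(z)}{1!}+\lambda_2\Big(\frac{nz}{2}\Big)^2\frac{P''(z)}{2!},$$ where $\lambda_0,\lambda_1,\lambda_2\in\mathbb C$ are such that all the zeros of $U(z)=\lambda_0+n\lambda_1z+\frac{n(n-1)}{2}\lambda_2z^2$ lie in the half plane $|z|\le|z-n/2|$. Let $k>0$, let $\alpha,\beta\in\mathbb C$ with $|\alpha|\le1$, $|\beta|\le1$, and let $R>r\ge k$ be real numbers. Put $\sigma(z)=Rz$, $\rho(z)=rz$ and $$\Phi_k=\Phi_k(R,r,\alpha,\beta)=\beta\left\{\left(\frac{R+k}{k+r}\right)^n-|\alpha|\right\}-\alpha .$$ Let $F$ be a complex polynomial of degree $n$ all of whose zeros lie in $|z|\le k$, and let $P$ be a complex polynomial of degree at most $n$ such that $|P(z)|\le|F(z)|$ for $|z|=k$. Then for every $z\in\mathbb C$ with $|z|\ge1$, $$\big|B[P\circ\sigma](z)+\Phi_k\,B[P\circ\rho](z)\big|\le\big|B[F\circ\sigma](z)+\Phi_k\,B[F\circ\rho](z)\big|.$$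 Equality holds for the polynomials $P=e^{i\gamma}F$, $\gamma\in\mathbb R$ (which satisfy the hypotheses on $P$). The result is best possible: if $n\ge1$, then for given $k,B,\alpha,\beta,R,r$ as above and any given $z$ with $|z|\ge1$, if a real constant $c$ is such that the left-hand side is at most $c$ times the right-hand side at $z$ for all such $F$ and $P$, then $c\ge1$. -/

import Mathlib

open Polynomial

/-- The polynomial `U(z) = l₀ + n l₁ z + (n(n-1)/2) l₂ z²` attached to the coefficients. -/
noncomputable def rahmanU (n : ℕ) (l₀ l₁ l₂ : ℂ) : ℂ[X] :=
  C l₀ + C ((n : ℂ) * l₁) * X + C ((n : ℂ) * ((n : ℂ) - 1) / 2 * l₂) * X ^ 2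

/-- The polynomial `l₀ P(z) + l₁ (nz/2) P'(z)/1! + l₂ (nz/2)² P''(z)/2!`. -/
noncomputable def rahmanOp (n : ℕ) (l₀ l₁ l₂ : ℂ) (P : ℂ[X]) : ℂ[X] :=
  C l₀ * P + C l₁ * (C ((n : ℂ) / 2) * X) * derivative P
    + C l₂ * (C ((n : ℂ) / 2) * X) ^ 2 * (C (1 / 2) * derivative (derivative P))

/-- Rahman's class of operators on the polynomials of degree at most `n`: those of the form
`rahmanOp n l₀ l₁ l₂` there, where all zeros of `U` lie in the half plane `|z| ≤ |z - n/2|`.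
The values of the operator on polynomials of larger degree are irrelevant. -/
def RahmanClass (n : ℕ) : Set (ℂ[X] → ℂ[X]) :=
  {B | ∃ l₀ l₁ l₂ : ℂ,
    (∀ z : ℂ, (rahmanU n l₀ l₁ l₂).IsRoot z → ‖z‖ ≤ ‖z - (n : ℂ) / 2‖) ∧
    ∀ P : ℂ[X], P.degree ≤ n → B P = rahmanOp n l₀ l₁ l₂ P}

/-- `Φ_k(R, r, α, β) = β {((R + k)/(k + r))^n - |α|} - α`. -/
noncomputable def rahmanPhi (n : ℕ) (k R r : ℝ) (α β : ℂ) : ℂ :=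
  β * (((((R + k) / (k + r)) ^ n - ‖α‖ : ℝ)) : ℂ) - α

/-- The polynomial `z ↦ P(s z)`. -/
noncomputable def dilate (s : ℝ) (P : ℂ[X]) : ℂ[X] := P.comp (C (s : ℂ) * X)

/-- The value `B[P∘σ](z) + Φ_k(R, r, α, β) B[P∘ρ](z)`, with `σ(z) = Rz` and `ρ(z) = rz`. -/
noncomputable def rahmanExpr (n : ℕ) (B : ℂ[X] → ℂ[X]) (k R r : ℝ) (α β : ℂ)
    (P : ℂ[X]) (z : ℂ) : ℂ :=
  (B (dilate R P)).eval z + rahmanPhi n k R r α β * (B (dilate r P)).eval z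

/-- The hypotheses on the pair `F`, `P`: `F` has degree `n` and all its zeros in `|z| ≤ k`,
`P` has degree at most `n`, and `|P(z)| ≤ |F(z)|` for `|z| = k`. -/
def Dominates (n : ℕ) (k : ℝ) (F P : ℂ[X]) : Prop :=
  F.degree = n ∧ (∀ z : ℂ, F.IsRoot z → ‖z‖ ≤ k) ∧ P.degree ≤ n ∧
    ∀ z : ℂ, ‖z‖ = k → ‖P.eval z‖ ≤ ‖F.eval z‖

/-! For fixed `z` with `|z| ≥ 1` and `n ≥ 1`, let `T` be the linear functional `T Q = B[Q∘σ](z) + Φ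
B[Q∘ρ](z)`. If `|T P| > |T F|`, put `λ = T P / T F`, so that `|λ| > 1` and `T (P - λF) = 0`. By the
maximum principle for `P / F` outside the circle, `G = P - λF` again has degree `n` and all its
zeros in `|z| ≤ k`. So it suffices that `T G ≠ 0` for every such `G`, which includes `F` itself.

This needs two facts. Each linear factor grows by at least `(R+k)/(k+r)` from `rz` to `Rz`
(`norm_eval_growth`), so for `|Φ| < ((R+k)/(k+r))^n` the polynomial `G(Rz) + Φ G(rz)` has all its
zeros in the open unit disc. And `B` keeps zeros there (`rahmanOp_eval_ne_zero`): Gauss–Lucas finds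
`p`, `q` in a half plane for which `B[H](z)` is `H(z)` times the polar form of `U` at `np/2`,
`nq/2`, and Walsh coincidence makes that form nonzero. The strict bound on `Φ` holds for `|β| < 1`;
the case `|β| = 1` is a limit. -/

/-! ### Rahman's operators and zeros in the unit disc -/

/-- Two-variable Walsh coincidence for the half plane `s < re z`. -/
lemma polarized_quadratic_ne_zero {s : ℝ} {a₀ a₁ a₂ : ℂ}
    (h : ∀ z : ℂ, s < z.re → a₀ + a₁ * z + a₂ * z ^ 2 ≠ 0) {p q : ℂ}
    (hp : s < p.re) (hq : s < q.re) : a₀ + a₁ * ((p + q) / 2) + a₂ * (p * q) ≠ 0 := by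
  intro h0
  by_cases ha : a₂ = 0
  · refine h ((p + q) / 2) ?_ (by rw [ha] at h0 ⊢; linear_combination h0)
    have : ((p + q) / 2).re = (p.re + q.re) / 2 := by simp
    rw [this]; linarith
  obtain ⟨w, hw⟩ := IsAlgClosed.exists_pow_nat_eq (a₁ ^ 2 - 4 * a₂ * a₀) (n := 2) two_pos
  obtain ⟨a, ha'⟩ : ∃ a, a = (-a₁ + w) / (2 * a₂) := ⟨_, rfl⟩
  obtain ⟨b, hb'⟩ : ∃ b, b = (-a₁ - w) / (2 * a₂) := ⟨_, rfl⟩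
  have e1 : a₁ = -a₂ * (a + b) := by rw [ha', hb']; field_simp; ring
  have e0 : a₀ = a₂ * (a * b) := by
    rw [ha', hb']; field_simp; linear_combination hw
  have key : ∀ c : ℂ, (c = a ∨ c = b) → c.re ≤ s := by
    intro c hc
    by_contra! hlt
    refine h c hlt ?_
    rw [e0, e1]
    rcases hc with rfl | rfl <;> ring
  have hA := key a (Or.inl rfl)
  have hB := key b (Or.inr rfl)
  -- In terms of the roots `a`, `b`, the polar form is half of `a₂` times this sum.
  have h1 : (p - a) * (q - b) + (p - b) * (q - a) = 0 := by
    have : a₂ * ((p - a) * (q - b) + (p - b) * (q - a)) = 0 := by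
      rw [e0, e1] at h0; linear_combination 2 * h0
    exact (mul_eq_zero.1 this).resolve_left ha
  have hpa : p - a ≠ 0 := fun e => by rw [sub_eq_zero] at e; rw [e] at hp; linarith
  have hpb : p - b ≠ 0 := fun e => by rw [sub_eq_zero] at e; rw [e] at hp; linarith
  have hsum : (p - q) * ((p - a)⁻¹ + (p - b)⁻¹) = 2 := by
    field_simp; linear_combination -h1
  obtain ⟨d, hd⟩ : ∃ d : ℝ, d = p.re - s := ⟨_, rfl⟩
  have hd0 : 0 < d := by linarith
  -- the half plane `d ≤ re x` is inverted to the disc `d * |y|² ≤ re y`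
  have inv : ∀ x : ℂ, x ≠ 0 → d ≤ x.re → d * Complex.normSq x⁻¹ ≤ (x⁻¹).re := by
    intro x hx hxd
    rw [Complex.inv_re, map_inv₀, div_eq_mul_inv]
    exact mul_le_mul_of_nonneg_right hxd (inv_nonneg.2 (Complex.normSq_nonneg x))
  have i1 := inv _ hpa (by simp; linarith)
  have i2 := inv _ hpb (by simp; linarith)
  obtain ⟨x, hx⟩ : ∃ x, x = (p - a)⁻¹ := ⟨_, rfl⟩
  obtain ⟨y, hy⟩ : ∃ y, y = (p - b)⁻¹ := ⟨_, rfl⟩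
  rw [← hx] at i1 hsum
  rw [← hy] at i2 hsum
  have hxy : x + y ≠ 0 := fun e => by rw [e] at hsum; norm_num at hsum
  have hpq : p - q = 2 * (x + y)⁻¹ := by field_simp; linear_combination hsum
  have hn : 0 < Complex.normSq (x + y) := Complex.normSq_pos.2 hxy
  have hre : (p - q).re * Complex.normSq (x + y) = 2 * (x + y).re := by
    rw [hpq]
    have : (2 * (x + y)⁻¹).re = 2 * ((x + y).re / Complex.normSq (x + y)) := by
      rw [← Complex.inv_re]; simp
    rw [this]; field_simp
  -- The disc is convex, so it contains the mean `(x + y) / 2 = 1 / (p - q)`. Inverting back gives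
  -- `re (p - q) ≥ d = re p - s`, that is `re q ≤ s`, a contradiction.
  simp only [Complex.normSq_apply, Complex.add_re, Complex.add_im, Complex.sub_re] at *
  have : (p.re - q.re) < d := by linarith
  nlinarith [sq_nonneg (x.re - y.re), sq_nonneg (x.im - y.im),
    mul_nonneg hd0.le (sq_nonneg (x.re - y.re)), mul_nonneg hd0.le (sq_nonneg (x.im - y.im))]

/-- Gauss–Lucas, iterated. -/
lemma iterate_derivative_roots_mem {s : Set ℂ} (hs : Convex ℝ s) {n : ℕ} {f : ℂ[X]}
    (hn : f.natDegree = n) (hf : ∀ z, f.IsRoot z → z ∈ s) (m : ℕ) (hm : m < n) :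
    (derivative^[m] f).natDegree = n - m ∧ ∀ z, (derivative^[m] f).IsRoot z → z ∈ s := by
  induction m with
  | zero => exact ⟨by simpa using hn, by simpa using hf⟩
  | succ m ih =>
    obtain ⟨h1, h2⟩ := ih (by omega)
    rw [Function.iterate_succ_apply']
    set g := derivative^[m] f
    have hd : g.derivative.natDegree = n - (m + 1) := by
      rw [natDegree_derivative, h1]; omega
    refine ⟨hd, fun z hz => ?_⟩
    have hg0 : 0 < g.degree := natDegree_pos_iff_degree_pos.1 (by omega)
    have hd0 : g.derivative ≠ 0 := by
      intro e
      have := derivative_eq_zero.1 e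
      omega
    have hmem : z ∈ g.derivative.rootSet ℂ := by
      rw [mem_rootSet]; exact ⟨hd0, by simpa using hz⟩
    have := rootSet_derivative_subset_convexHull_rootSet hg0 hmem
    refine convexHull_min ?_ hs this
    intro w hw
    rw [mem_rootSet] at hw
    exact h2 w (by simpa using hw.2)

/-- The three leading coefficients of a polynomial with zeros in a convex set are those of a
polynomial with only two distinct zeros in that set, up to the usual binomial weights. -/
lemma exists_pair_of_roots_mem {s : Set ℂ} (hs : Convex ℝ s) {n : ℕ} (hn : 1 ≤ n) {f : ℂ[X]}
    (hdeg : f.natDegree = n) (hf : ∀ z, f.IsRoot z → z ∈ s) :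
    ∃ p ∈ s, ∃ q ∈ s, f.coeff (n - 1) = -(n * ((p + q) / 2) * f.coeff n) ∧
      (2 ≤ n → f.coeff (n - 2) = n * (n - 1) / 2 * (p * q) * f.coeff n) := by
  have hlead : f.coeff n ≠ 0 := by
    rw [← hdeg]
    exact leadingCoeff_ne_zero.2 (by rintro rfl; simp at hdeg; omega)
  rcases Nat.lt_or_ge n 2 with h | h
  · obtain rfl : n = 1 := by omega
    refine ⟨-f.coeff 0 / f.coeff 1, ?_, -f.coeff 0 / f.coeff 1, ?_, ?_, by omega⟩
    all_goals first
      | (apply hf; rw [IsRoot.def, eval_eq_sum_range, hdeg]; simp [Finset.sum_range_succ]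
         field_simp; ring)
      | (simp; field_simp)
  · obtain ⟨m, rfl⟩ : ∃ m, n = m + 2 := ⟨n - 2, by omega⟩
    -- The derivative of order `n - 2` is a quadratic built from the three leading coefficients of
    -- `f`; `p` and `q` are its roots.
    obtain ⟨h1, h2⟩ := iterate_derivative_roots_mem hs hdeg hf m (by omega)
    set g := derivative^[m] f with hg
    have h1' : g.natDegree = 2 := by rw [h1]; omega
    have c2 : g.coeff 2 = ((m + 2).descFactorial m : ℂ) * f.coeff (m + 2) := by
      rw [hg, coeff_iterate_derivative, add_comm 2 m, nsmul_eq_mul]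
    have c1 : g.coeff 1 = ((m + 1).descFactorial m : ℂ) * f.coeff (m + 1) := by
      rw [hg, coeff_iterate_derivative, add_comm 1 m, nsmul_eq_mul]
    have c0 : g.coeff 0 = ((m).descFactorial m : ℂ) * f.coeff m := by
      rw [hg, coeff_iterate_derivative, zero_add, nsmul_eq_mul]
    have d0 : (m.descFactorial m : ℂ) ≠ 0 := by
      rw [Nat.descFactorial_self]; exact_mod_cast m.factorial_ne_zero
    have d1 : ((m + 1).descFactorial m : ℂ) = (m + 1) * m.descFactorial m := by
      have : (m + 1).descFactorial m = (m + 1) * m.descFactorial m := by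
        have := Nat.factorial_mul_descFactorial (n := m + 1) (k := m) (by omega)
        simp only [Nat.add_sub_cancel_left, Nat.factorial_one, one_mul] at this
        rw [this, Nat.descFactorial_self, Nat.factorial_succ]
      exact_mod_cast this
    have d2 : 2 * ((m + 2).descFactorial m : ℂ) = (m + 2) * (m + 1) * m.descFactorial m := by
      have : 2 * (m + 2).descFactorial m = (m + 2) * (m + 1) * m.descFactorial m := by
        have := Nat.factorial_mul_descFactorial (n := m + 2) (k := m) (by omega)
        simp only [Nat.add_sub_cancel_left, Nat.factorial_two] at this
        rw [this, Nat.descFactorial_self, Nat.factorial_succ, Nat.factorial_succ, mul_assoc]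
      exact_mod_cast this
    have ev : ∀ z, g.eval z = g.coeff 0 + g.coeff 1 * z + g.coeff 2 * z ^ 2 := by
      intro z
      rw [eval_eq_sum_range, h1']; simp [Finset.sum_range_succ]
    have hm1 : (m : ℂ) + 1 ≠ 0 := by exact_mod_cast Nat.succ_ne_zero m
    have hm2 : (m : ℂ) + 2 ≠ 0 := by exact_mod_cast Nat.succ_ne_zero (m + 1)
    have hc2 : g.coeff 2 ≠ 0 := by
      rw [← h1']; exact leadingCoeff_ne_zero.2 (by intro e; rw [e] at h1'; simp at h1')
    obtain ⟨w, hw⟩ := IsAlgClosed.exists_pow_nat_eq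
      (g.coeff 1 ^ 2 - 4 * g.coeff 2 * g.coeff 0) (n := 2) two_pos
    obtain ⟨p, hp⟩ : ∃ p, p = (-g.coeff 1 + w) / (2 * g.coeff 2) := ⟨_, rfl⟩
    obtain ⟨q, hq⟩ : ∃ q, q = (-g.coeff 1 - w) / (2 * g.coeff 2) := ⟨_, rfl⟩
    have e1 : g.coeff 1 = -g.coeff 2 * (p + q) := by rw [hp, hq]; field_simp; ring
    have e0 : g.coeff 0 = g.coeff 2 * (p * q) := by
      rw [hp, hq]; field_simp; linear_combination hw
    refine ⟨p, h2 p ?_, q, h2 q ?_, ?_, fun _ => ?_⟩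
    · rw [IsRoot.def, ev, e0, e1]; ring
    · rw [IsRoot.def, ev, e0, e1]; ring
    · rw [c1, c2, d1] at e1
      have : ((m : ℂ) + 1) * m.descFactorial m * (f.coeff (m + 1) +
          (m + 2) * ((p + q) / 2) * f.coeff (m + 2)) = 0 := by
        linear_combination e1 + f.coeff (m + 2) * (p + q) / (-2) * d2
      have := (mul_eq_zero.1 this).resolve_left (mul_ne_zero hm1 d0)
      simp only [Nat.add_succ_sub_one]
      push_cast
      linear_combination this
    · rw [c0, c2] at e0
      have : (m.descFactorial m : ℂ) * (f.coeff m -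
          (m + 2) * (m + 1) / 2 * (p * q) * f.coeff (m + 2)) = 0 := by
        linear_combination e0 + f.coeff (m + 2) * (p * q) / 2 * d2
      have := (mul_eq_zero.1 this).resolve_left d0
      simp only [Nat.add_sub_cancel]
      push_cast
      linear_combination this

lemma half_lt_re_of_norm_lt {x : ℂ} (h : ‖x - 1‖ < ‖x‖) : 1 / 2 < x.re := by
  have h2 : ‖x - 1‖ ^ 2 < ‖x‖ ^ 2 := by gcongr
  rw [← Complex.normSq_eq_norm_sq, ← Complex.normSq_eq_norm_sq, Complex.normSq_apply,
    Complex.normSq_apply] at h2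
  simp at h2
  nlinarith

/-- Operators in Rahman's class preserve the property of having all zeros in the open unit disc. -/
lemma rahmanOp_eval_ne_zero {n : ℕ} (hn : 1 ≤ n) {l₀ l₁ l₂ : ℂ}
    (hU : ∀ z : ℂ, (rahmanU n l₀ l₁ l₂).IsRoot z → ‖z‖ ≤ ‖z - (n : ℂ) / 2‖)
    {H : ℂ[X]} (hdeg : H.natDegree = n) (hH : ∀ z : ℂ, 1 ≤ ‖z‖ → H.eval z ≠ 0)
    {z : ℂ} (hz : 1 ≤ ‖z‖) : (rahmanOp n l₀ l₁ l₂ H).eval z ≠ 0 := by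
  have hz0 : z ≠ 0 := fun e => by rw [e] at hz; norm_num at hz
  have hn0 : (0 : ℝ) < n := by exact_mod_cast hn
  -- The three lowest coefficients of `K(x) = H(z - zx)` carry the derivatives of `H` that enter the
  -- operator; the reversal `f` below makes them leading coefficients.
  set K := (taylor z H).comp (C (-z) * X) with hK
  have Kc : ∀ i, K.coeff i = (hasseDeriv i H).eval z * (-z) ^ i := fun i => by
    rw [hK, comp_C_mul_X_coeff, taylor_coeff]
  have Kev : ∀ x, K.eval x = H.eval (z - z * x) := fun x => by
    rw [hK, eval_comp, taylor_eval]; congr 1; simp; ring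
  have Kn : K.natDegree = n := by
    rw [hK, natDegree_comp, natDegree_taylor, hdeg, natDegree_C_mul_X _ (neg_ne_zero.2 hz0),
      mul_one]
  have K0 : K.coeff 0 = H.eval z := by rw [Kc]; simp
  have K0ne : K.coeff 0 ≠ 0 := by rw [K0]; exact hH z hz
  have K1 : K.coeff 1 = -z * (derivative H).eval z := by rw [Kc]; simp; ring
  have K2 : K.coeff 2 * 2 = z ^ 2 * (derivative (derivative H)).eval z := by
    have := congrArg (eval z) (congrFun (factorial_smul_hasseDeriv (R := ℂ) 2) H)
    simp [Nat.factorial_two] at this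
    rw [Kc, ← this]; simp; ring
  set f := reflect n K with hf
  have fc : ∀ i ≤ n, f.coeff (n - i) = K.coeff i := fun i hi => by
    rw [hf, coeff_reflect, revAt_le (by omega)]; congr 1; omega
  have fn : f.coeff n = K.coeff 0 := fc 0 (by omega)
  have fdeg : f.natDegree = n := by
    refine natDegree_eq_of_le_of_coeff_ne_zero ?_ (by rw [fn]; exact K0ne)
    rw [natDegree_le_iff_coeff_eq_zero]
    intro N hN
    rw [hf, coeff_reflect, revAt_eq_self_of_lt hN]
    exact coeff_eq_zero_of_natDegree_lt (by omega)
  -- A root `x` of `f` gives the zero `z(1 - 1/x)` of `H`, which has modulus less than `1`; as `|z|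
  -- ≥ 1`, `x` is nearer to `1` than to `0`.
  have froot : ∀ x, f.IsRoot x → x ∈ {x : ℂ | 1 / 2 < x.re} := by
    intro x hx
    have hx0 : x ≠ 0 := by
      rintro rfl
      rw [IsRoot.def, ← coeff_zero_eq_eval_zero] at hx
      have := fc n le_rfl
      rw [Nat.sub_self, hx, ← Kn, coeff_natDegree] at this
      have := leadingCoeff_eq_zero.1 this.symm
      rw [this] at K0ne; simp at K0ne
    have : K.eval x⁻¹ = 0 := by
      let _ := invertibleOfNonzero (inv_ne_zero hx0)
      have := eval₂_reflect_mul_pow (RingHom.id ℂ) x⁻¹ n K Kn.le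
      rw [invOf_eq_inv, inv_inv] at this
      rw [eval, ← this]
      have hx' : eval₂ (RingHom.id ℂ) x (reflect n K) = 0 := hx
      rw [hx', zero_mul]
    rw [Kev] at this
    have hlt : ‖z - z * x⁻¹‖ < 1 := by
      by_contra! h; exact hH _ h this
    apply half_lt_re_of_norm_lt
    have e : z - z * x⁻¹ = z * (x - 1) / x := by field_simp
    rw [e, norm_div, norm_mul, div_lt_one (norm_pos_iff.2 hx0)] at hlt
    nlinarith [norm_nonneg (x - 1)]
  obtain ⟨p, hp, q, hq, h1, h2⟩ :=
    exists_pair_of_roots_mem (convex_halfSpace_re_gt (1 / 2)) hn fdeg froot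
  rw [fc 1 hn, fn, K1, K0] at h1
  have h2' : z ^ 2 * (derivative (derivative H)).eval z =
      n * (n - 1) * (p * q) * H.eval z := by
    rcases Nat.lt_or_ge n 2 with h | h
    · obtain rfl : n = 1 := by omega
      have : derivative (derivative H) = 0 := by
        have h' : (derivative H).natDegree = 0 := by
          have := natDegree_derivative_le H; omega
        rw [eq_C_of_natDegree_eq_zero h', derivative_C]
      rw [this]; simp
    · have := h2 h
      rw [fc 2 h, fn, K0] at this
      linear_combination -K2 + 2 * this
  -- The half plane `|w| ≤ |w - n/2|` is `re w ≤ n/4`; scaling by `n/2` sends `re > 1/2` to its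
  -- complement.
  have hU' : ∀ w : ℂ, (n : ℝ) / 4 < w.re →
      l₀ + (n * l₁) * w + (n * (n - 1) / 2 * l₂) * w ^ 2 ≠ 0 := by
    intro w hw h0
    have hr := hU w (by simpa [rahmanU] using h0)
    have h3 : ‖w‖ ^ 2 ≤ ‖w - (n : ℂ) / 2‖ ^ 2 := by gcongr
    rw [← Complex.normSq_eq_norm_sq, ← Complex.normSq_eq_norm_sq, Complex.normSq_apply,
      Complex.normSq_apply] at h3
    simp at h3
    nlinarith
  simp only [Set.mem_ofPred_eq] at hp hq
  have main := polarized_quadratic_ne_zero hU' (p := (n / 2 : ℝ) * p) (q := (n / 2 : ℝ) * q)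
    (by rw [Complex.re_ofReal_mul]; nlinarith) (by rw [Complex.re_ofReal_mul]; nlinarith)
  intro h0
  refine mul_ne_zero main (hH z hz) ?_
  rw [← h0]
  simp only [rahmanOp, eval_add, eval_mul, eval_C, eval_pow, eval_X]
  push_cast
  linear_combination (l₁ * n / 2) * h1 - l₂ * n ^ 2 / 8 * h2'

/-! ### Maximum modulus outside a disc -/

open Filter Topology in
/-- A non-strict inequality between polynomials on a punctured circle extends to the circle. -/
lemma norm_eval_le_of_punctured_circle {k : ℝ} (hk : 0 < k) {w : ℂ} (hw : ‖w‖ = k) {F P : ℂ[X]}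
    (h : ∀ z : ℂ, ‖z‖ = k → z ≠ w → ‖P.eval z‖ ≤ ‖F.eval z‖) : ‖P.eval w‖ ≤ ‖F.eval w‖ := by
  have hw0 : w ≠ 0 := norm_pos_iff.1 (hw ▸ hk)
  have hc : ∀ Q : ℂ[X], Tendsto (fun t : ℝ => ‖Q.eval (w * Complex.exp (t * Complex.I))‖)
      (𝓝[>] 0) (𝓝 ‖Q.eval w‖) := by
    intro Q
    have : Continuous fun t : ℝ => ‖Q.eval (w * Complex.exp (t * Complex.I))‖ := by fun_prop
    have := this.tendsto 0
    simp only [Complex.ofReal_zero, zero_mul, Complex.exp_zero, mul_one] at this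
    exact this.mono_left nhdsWithin_le_nhds
  refine le_of_tendsto_of_tendsto (hc P) (hc F) ?_
  filter_upwards [Ioc_mem_nhdsGT (zero_lt_one' ℝ)] with t ht
  refine h _ (by rw [norm_mul, Complex.norm_exp_ofReal_mul_I, mul_one, hw]) ?_
  intro e
  have e1 : Complex.exp (t * Complex.I) = 1 := mul_left_cancel₀ hw0 (by rw [e, mul_one])
  have := congrArg Complex.im e1
  rw [Complex.exp_ofReal_mul_I_im, Complex.one_im] at this
  exact (Real.sin_pos_of_pos_of_le_one ht.1 ht.2).ne' this

lemma eval_reflect_mul_pow {n : ℕ} {P : ℂ[X]} (hP : P.natDegree ≤ n) {z : ℂ} (hz : z ≠ 0) :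
    (reflect n P).eval z⁻¹ * z ^ n = P.eval z := by
  let _ := invertibleOfNonzero hz
  have := eval₂_reflect_mul_pow (RingHom.id ℂ) z n P hP
  rwa [invOf_eq_inv] at this

lemma eval_zero_reflect (n : ℕ) (P : ℂ[X]) : (reflect n P).eval 0 = P.coeff n := by
  rw [← coeff_zero_eq_eval_zero, coeff_reflect, revAt_le (Nat.zero_le n), Nat.sub_zero]

/-- Maximum modulus principle outside a disc, for a denominator with no zeros on the circle. -/
lemma norm_eval_le_of_circle_of_ne_zero {k : ℝ} (hk : 0 < k) {n : ℕ} {F P : ℂ[X]}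
    (hF : F.natDegree = n) (hF0 : F ≠ 0) (hroot : ∀ z, k ≤ ‖z‖ → F.eval z ≠ 0)
    (hP : P.natDegree ≤ n)
    (h : ∀ z : ℂ, ‖z‖ = k → ‖P.eval z‖ ≤ ‖F.eval z‖) :
    (∀ z : ℂ, k ≤ ‖z‖ → ‖P.eval z‖ ≤ ‖F.eval z‖) ∧ ‖P.coeff n‖ ≤ ‖F.coeff n‖ := by
  -- The substitution `u = 1/z` turns the exterior into a disc. Its centre stands for infinity,
  -- where the reflected polynomials take the coefficients of index `n` as values.
  have hne : ∀ u ∈ Metric.closedBall (0 : ℂ) k⁻¹, (reflect n F).eval u ≠ 0 := by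
    intro u hu
    rw [mem_closedBall_zero_iff] at hu
    by_cases hu0 : u = 0
    · rw [hu0, eval_zero_reflect, ← hF]; exact leadingCoeff_ne_zero.2 hF0
    · intro e
      have h1 : k ≤ ‖u⁻¹‖ := by
        rw [norm_inv]; exact (le_inv_comm₀ hk (norm_pos_iff.2 hu0)).2 hu
      apply hroot _ h1
      rw [← eval_reflect_mul_pow hF.le (inv_ne_zero hu0), inv_inv, e, zero_mul]
  have hk' : k⁻¹ ≠ 0 := (inv_pos.2 hk).ne'
  have hdiff : DiffContOnCl ℂ (fun u => (reflect n P).eval u / (reflect n F).eval u)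
      (Metric.ball 0 k⁻¹) := by
    apply DifferentiableOn.diffContOnCl
    rw [closure_ball _ hk']
    exact (reflect n P).differentiable.differentiableOn.div
      (reflect n F).differentiable.differentiableOn hne
  have main : ∀ u ∈ Metric.closedBall (0 : ℂ) k⁻¹,
      ‖(reflect n P).eval u‖ ≤ ‖(reflect n F).eval u‖ := by
    intro u hu
    have := Complex.norm_le_of_forall_mem_frontier_norm_le Metric.isBounded_ball hdiff (C := 1)
      (z := u) (fun v hv => by
        rw [frontier_ball _ hk', mem_sphere_zero_iff_norm] at hv
        have hv0 : v ≠ 0 := norm_pos_iff.1 (by rw [hv]; positivity)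
        have h1 := h v⁻¹ (by rw [norm_inv, hv, inv_inv])
        rw [← eval_reflect_mul_pow hF.le (inv_ne_zero hv0),
          ← eval_reflect_mul_pow hP (inv_ne_zero hv0), inv_inv, norm_mul, norm_mul] at h1
        have h2 := le_of_mul_le_mul_right h1
          (norm_pos_iff.2 (pow_ne_zero n (inv_ne_zero hv0)))
        rw [norm_div]
        exact div_le_one_of_le₀ h2 (norm_nonneg _))
      (by rwa [closure_ball _ hk'])
    rwa [norm_div, div_le_one (norm_pos_iff.2 (hne u hu))] at this
  refine ⟨fun z hz => ?_, ?_⟩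
  · have hz0 : z ≠ 0 := norm_pos_iff.1 (hk.trans_le hz)
    rw [← eval_reflect_mul_pow hF.le hz0, ← eval_reflect_mul_pow hP hz0, norm_mul, norm_mul]
    gcongr
    apply main
    rw [mem_closedBall_zero_iff, norm_inv]
    exact inv_anti₀ hk hz
  · have := main 0 (by simp [hk.le])
    rwa [eval_zero_reflect, eval_zero_reflect] at this

/-- Maximum modulus principle outside a disc: zeros of the denominator on the circle cancel. -/
lemma norm_eval_le_of_circle {k : ℝ} (hk : 0 < k) {n : ℕ} {F P : ℂ[X]}
    (hF : F.natDegree = n) (hF0 : F ≠ 0) (hroot : ∀ z, F.IsRoot z → ‖z‖ ≤ k)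
    (hP : P.natDegree ≤ n)
    (h : ∀ z : ℂ, ‖z‖ = k → ‖P.eval z‖ ≤ ‖F.eval z‖) :
    (∀ z : ℂ, k ≤ ‖z‖ → ‖P.eval z‖ ≤ ‖F.eval z‖) ∧ ‖P.coeff n‖ ≤ ‖F.coeff n‖ := by
  induction n generalizing F P with
  | zero =>
    refine norm_eval_le_of_circle_of_ne_zero hk hF hF0 (fun z _ e => hF0 ?_) hP h
    rw [eq_C_of_natDegree_eq_zero hF, eval_C] at e
    rw [eq_C_of_natDegree_eq_zero hF, e, C_0]
  | succ n ih =>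
    by_cases hw : ∃ w, ‖w‖ = k ∧ F.IsRoot w
    · obtain ⟨w, hwk, hwF⟩ := hw
      have hwP : P.IsRoot w := by
        have := h w hwk
        rw [IsRoot.def.1 hwF, norm_zero] at this
        exact norm_le_zero_iff.1 this
      obtain ⟨F₁, rfl⟩ := dvd_iff_isRoot.2 hwF
      obtain ⟨P₁, rfl⟩ := dvd_iff_isRoot.2 hwP
      have hF₁ : F₁ ≠ 0 := right_ne_zero_of_mul hF0
      have hdF : F₁.natDegree = n := by
        rw [natDegree_mul (X_sub_C_ne_zero w) hF₁, natDegree_X_sub_C] at hF; omega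
      have hdP : P₁.natDegree ≤ n := by
        by_cases hP₁ : P₁ = 0
        · simp [hP₁]
        rw [natDegree_mul (X_sub_C_ne_zero w) hP₁, natDegree_X_sub_C] at hP; omega
      have hpt : ∀ z : ℂ, ‖z‖ = k → z ≠ w → ‖P₁.eval z‖ ≤ ‖F₁.eval z‖ := by
        intro z hz hzw
        have := h z hz
        simp only [eval_mul, eval_sub, eval_X, eval_C, norm_mul] at this
        exact le_of_mul_le_mul_left this (norm_pos_iff.2 (sub_ne_zero.2 hzw))
      obtain ⟨i1, i2⟩ := ih hdF hF₁
        (fun z hz => hroot z (by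
          rw [IsRoot.def, eval_mul, IsRoot.def.1 hz, mul_zero])) hdP (fun z hz => by
          by_cases hzw : z = w
          · rw [hzw]; exact norm_eval_le_of_punctured_circle hk hwk hpt
          · exact hpt z hz hzw)
      refine ⟨fun z hz => ?_, ?_⟩
      · rw [eval_mul, eval_mul, norm_mul, norm_mul]
        exact mul_le_mul_of_nonneg_left (i1 z hz) (norm_nonneg _)
      · have e : ∀ Q : ℂ[X], Q.natDegree ≤ n → ((X - C w) * Q).coeff (n + 1) = Q.coeff n := by
          intro Q hQ
          rw [sub_mul, coeff_sub, coeff_X_mul, coeff_C_mul,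
            coeff_eq_zero_of_natDegree_lt (n := n + 1) (by omega), mul_zero, sub_zero]
        rw [e _ hdF.le, e _ hdP]; exact i2
    · push Not at hw
      refine norm_eval_le_of_circle_of_ne_zero hk hF hF0 (fun z hz e => ?_) hP h
      exact hw z (le_antisymm (hroot z e) hz) e

/-- If `F` dominates `P` on the circle, then `P - lam F` has its degree and zeros where `F` has. -/
lemma sub_C_mul_of_norm_le {k : ℝ} (hk : 0 < k) {n : ℕ} {F P : ℂ[X]}
    (hF : F.natDegree = n) (hF0 : F ≠ 0) (hroot : ∀ z, F.IsRoot z → ‖z‖ ≤ k)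
    (hP : P.natDegree ≤ n) (h : ∀ z : ℂ, ‖z‖ = k → ‖P.eval z‖ ≤ ‖F.eval z‖)
    {lam : ℂ} (hlam : 1 < ‖lam‖) :
    (P - C lam * F).natDegree = n ∧ P - C lam * F ≠ 0 ∧
      ∀ z, (P - C lam * F).IsRoot z → ‖z‖ ≤ k := by
  obtain ⟨h1, h2⟩ := norm_eval_le_of_circle hk hF hF0 hroot hP h
  have key : ∀ a b : ℂ, ‖a‖ ≤ ‖b‖ → b ≠ 0 → a - lam * b ≠ 0 := by
    intro a b hab hb e
    rw [sub_eq_zero.1 e, norm_mul] at hab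
    have := norm_pos_iff.2 hb
    nlinarith
  have hlead : F.coeff n ≠ 0 := by rw [← hF]; exact leadingCoeff_ne_zero.2 hF0
  have hc : (P - C lam * F).coeff n ≠ 0 := by
    rw [coeff_sub, coeff_C_mul]; exact key _ _ h2 hlead
  refine ⟨natDegree_eq_of_le_of_coeff_ne_zero ?_ hc, fun e => hc (by rw [e, coeff_zero]), ?_⟩
  · exact (natDegree_sub_le _ _).trans (max_le hP ((natDegree_C_mul_le _ _).trans hF.le))
  · intro z hz
    by_contra! hlt
    rw [IsRoot.def, eval_sub, eval_mul, eval_C] at hz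
    exact key _ _ (h1 z hlt.le) (fun e => absurd (hroot z e) (not_le.2 hlt)) hz

/-! ### Growth between two radii and the size of `Φ` -/

/-- After squaring and clearing denominators, the difference of the two sides is affine in `t = re
(z * conj w)` with slope `2(R - r)(Rr - k²) ≥ 0`. It is therefore least at `t = -|z||w|`, where `z`
and `w` point in opposite directions and the claim is elementary. -/
lemma norm_real_mul_sub_le {k R r : ℝ} (hk : 0 < k) (hr : k ≤ r) (hR : r < R) {z w : ℂ}
    (hz : 1 ≤ ‖z‖) (hw : ‖w‖ ≤ k) :
    (R + k) / (k + r) * ‖(r : ℂ) * z - w‖ ≤ ‖(R : ℂ) * z - w‖ := by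
  rw [div_mul_eq_mul_div, div_le_iff₀ (by linarith), mul_comm _ (k + r)]
  refine le_of_sq_le_sq ?_ (by have := norm_nonneg ((R : ℂ) * z - w); nlinarith)
  obtain ⟨t, ht⟩ : ∃ t, t = z.re * w.re + z.im * w.im := ⟨_, rfl⟩
  obtain ⟨a, ha⟩ : ∃ a, a = ‖z‖ := ⟨_, rfl⟩
  obtain ⟨b, hb⟩ : ∃ b, b = ‖w‖ := ⟨_, rfl⟩
  have ha2 : a ^ 2 = z.re ^ 2 + z.im ^ 2 := by
    rw [ha, ← Complex.normSq_eq_norm_sq, Complex.normSq_apply]; ring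
  have hb2 : b ^ 2 = w.re ^ 2 + w.im ^ 2 := by
    rw [hb, ← Complex.normSq_eq_norm_sq, Complex.normSq_apply]; ring
  have hexp : ∀ s : ℝ, ‖(s : ℂ) * z - w‖ ^ 2 = s ^ 2 * a ^ 2 - 2 * s * t + b ^ 2 := by
    intro s
    rw [← Complex.normSq_eq_norm_sq, Complex.normSq_apply, ha2, hb2, ht]
    simp; ring
  have ha1 : 1 ≤ a := ha ▸ hz
  have hb0 : 0 ≤ b := hb ▸ norm_nonneg w
  have hbk : b ≤ k := hb ▸ hw
  have htab : -(a * b) ≤ t := by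
    have : t ^ 2 ≤ (a * b) ^ 2 := by
      rw [mul_pow, ha2, hb2, ht]; nlinarith [sq_nonneg (z.re * w.im - z.im * w.re)]
    exact (abs_le.1 (abs_le_of_sq_le_sq this (by positivity))).1
  rw [mul_pow, mul_pow, hexp, hexp]
  have h1 : 0 ≤ (R - r) * (R * r - k ^ 2) * (t + a * b) := by
    have : 0 ≤ R * r - k ^ 2 := by nlinarith
    have := sub_nonneg.2 hR.le
    have : 0 ≤ t + a * b := by linarith
    positivity
  have h2 : (R + k) * (r * a + b) ≤ (k + r) * (R * a + b) := by
    have : 0 ≤ (R - r) * (k * a - b) := mul_nonneg (by linarith) (by nlinarith)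
    linarith
  have h3 : ((R + k) * (r * a + b)) ^ 2 ≤ ((k + r) * (R * a + b)) ^ 2 := by
    have : 0 ≤ (R + k) * (r * a + b) := mul_nonneg (by linarith) (by nlinarith)
    gcongr
  linarith

lemma norm_eval_growth {k R r : ℝ} (hk : 0 < k) (hr : k ≤ r) (hR : r < R) {n : ℕ} {G : ℂ[X]}
    (hG : G.natDegree = n) (hroot : ∀ z, G.IsRoot z → ‖z‖ ≤ k) {z : ℂ}
    (hz : 1 ≤ ‖z‖) :
    ((R + k) / (k + r)) ^ n * ‖G.eval (r * z)‖ ≤ ‖G.eval (R * z)‖ := by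
  have hs : G.Splits := IsAlgClosed.splits G
  have hcard : G.roots.card = n := by rw [← hG]; exact hs.natDegree_eq_card_roots.symm
  have hM : 0 ≤ (R + k) / (k + r) := div_nonneg (by linarith) (by linarith)
  have key : ∀ s : Multiset ℂ, (∀ w ∈ s, ‖w‖ ≤ k) →
      ((R + k) / (k + r)) ^ s.card * ‖(s.map fun w => (r * z - w)).prod‖ ≤
        ‖(s.map fun w => (R * z - w)).prod‖ := by
    intro s
    induction s using Multiset.induction_on with
    | empty => simp
    | cons w s ih =>
      intro hw
      have h1 := ih fun v hv => hw v (Multiset.mem_cons_of_mem hv)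
      have h2 := norm_real_mul_sub_le hk hr hR hz (hw w (Multiset.mem_cons_self w s))
      simp only [Multiset.map_cons, Multiset.prod_cons, Multiset.card_cons, norm_mul, pow_succ]
      calc _ = ((R + k) / (k + r) * ‖(r : ℂ) * z - w‖) *
            (((R + k) / (k + r)) ^ s.card * ‖(s.map fun w => (r * z - w)).prod‖) := by ring
        _ ≤ _ := mul_le_mul h2 h1 (by positivity) (norm_nonneg _)
  rw [hs.eval_eq_prod_roots, hs.eval_eq_prod_roots, norm_mul, norm_mul, mul_left_comm]
  refine mul_le_mul_of_nonneg_left ?_ (norm_nonneg _)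
  rw [← hcard]
  exact key _ fun w hw => hroot w (isRoot_of_mem_roots hw)

lemma one_lt_growth_base {k R r : ℝ} (hk : 0 < k) (hr : k ≤ r) (hR : r < R) :
    1 < (R + k) / (k + r) := by
  rw [one_lt_div (by linarith)]; linarith

/-- With `M` the right-hand side, `|Φ| ≤ |β|(M - |α|) + |α| ≤ M`, because `M ≥ 1 ≥ |α|`. -/
lemma norm_rahmanPhi_le {n : ℕ} {k R r : ℝ} {α β : ℂ} (hk : 0 < k) (hr : k ≤ r) (hR : r < R)
    (hα : ‖α‖ ≤ 1) (hβ : ‖β‖ ≤ 1) : ‖rahmanPhi n k R r α β‖ ≤ ((R + k) / (k + r)) ^ n := by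
  have hM : 1 ≤ ((R + k) / (k + r)) ^ n := one_le_pow₀ (one_lt_growth_base hk hr hR).le
  refine (norm_sub_le _ _).trans ?_
  rw [norm_mul, Complex.norm_real, Real.norm_of_nonneg (by linarith)]
  nlinarith

lemma norm_rahmanPhi_lt {n : ℕ} (hn : 1 ≤ n) {k R r : ℝ} {α β : ℂ} (hk : 0 < k) (hr : k ≤ r)
    (hR : r < R) (hα : ‖α‖ ≤ 1) (hβ : ‖β‖ < 1) :
    ‖rahmanPhi n k R r α β‖ < ((R + k) / (k + r)) ^ n := by
  have hM : 1 < ((R + k) / (k + r)) ^ n :=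
    one_lt_pow₀ (one_lt_growth_base hk hr hR) (by omega)
  refine (norm_sub_le _ _).trans_lt ?_
  rw [norm_mul, Complex.norm_real, Real.norm_of_nonneg (by linarith)]
  nlinarith

/-- This is the factor on the leading coefficient of `G(Rz) + φ G(rz)`. Since `R/r > (R+k)/(k+r)`,
it survives even for `|φ|` equal to the bound, which sharpness needs when `|β| = 1`. -/
lemma pow_add_mul_pow_ne_zero {n : ℕ} (hn : 1 ≤ n) {k R r : ℝ} (hk : 0 < k) (hr : k ≤ r)
    (hR : r < R) {φ : ℂ} (hφ : ‖φ‖ ≤ ((R + k) / (k + r)) ^ n) :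
    (R : ℂ) ^ n + φ * (r : ℂ) ^ n ≠ 0 := by
  have hr0 : 0 < r := by linarith
  intro e
  have h1 : ‖(R : ℂ) ^ n‖ = ‖φ‖ * r ^ n := by
    rw [eq_neg_of_add_eq_zero_left e, norm_neg, norm_mul, norm_pow, Complex.norm_real,
      Real.norm_of_nonneg hr0.le]
  rw [norm_pow, Complex.norm_real, Real.norm_of_nonneg (by linarith)] at h1
  have h2 : (R + k) / (k + r) * r < R := by
    rw [div_mul_eq_mul_div, div_lt_iff₀ (by linarith)]; nlinarith
  have h3 : ((R + k) / (k + r) * r) ^ n < R ^ n := by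
    have : 0 ≤ (R + k) / (k + r) * r :=
      mul_nonneg (div_nonneg (by linarith) (by linarith)) hr0.le
    exact pow_lt_pow_left₀ h2 this (by omega)
  rw [mul_pow] at h3
  have := mul_le_mul_of_nonneg_right hφ (pow_nonneg hr0.le n)
  linarith

/-! ### Dilations, linearity and the inequality -/

lemma eval_dilate (s : ℝ) (P : ℂ[X]) (z : ℂ) : (dilate s P).eval z = P.eval (s * z) := by
  simp [dilate]

lemma coeff_dilate (s : ℝ) (P : ℂ[X]) (i : ℕ) : (dilate s P).coeff i = P.coeff i * (s : ℂ) ^ i :=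
  comp_C_mul_X_coeff

lemma natDegree_dilate_le (s : ℝ) (P : ℂ[X]) : (dilate s P).natDegree ≤ P.natDegree := by
  rw [natDegree_le_iff_coeff_eq_zero]
  intro N hN
  rw [coeff_dilate, coeff_eq_zero_of_natDegree_lt hN, zero_mul]

lemma rahmanOp_add (n : ℕ) (l₀ l₁ l₂ : ℂ) (P Q : ℂ[X]) :
    rahmanOp n l₀ l₁ l₂ (P + Q) = rahmanOp n l₀ l₁ l₂ P + rahmanOp n l₀ l₁ l₂ Q := by
  simp only [rahmanOp, derivative_add]; ring

lemma rahmanOp_C_mul (n : ℕ) (l₀ l₁ l₂ c : ℂ) (P : ℂ[X]) :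
    rahmanOp n l₀ l₁ l₂ (C c * P) = C c * rahmanOp n l₀ l₁ l₂ P := by
  simp only [rahmanOp, derivative_C_mul]; ring

lemma rahmanOp_dilate_eval_ne_zero {n : ℕ} (hn : 1 ≤ n) {l₀ l₁ l₂ : ℂ}
    (hU : ∀ z : ℂ, (rahmanU n l₀ l₁ l₂).IsRoot z → ‖z‖ ≤ ‖z - (n : ℂ) / 2‖)
    {k R r : ℝ} (hk : 0 < k) (hr : k ≤ r) (hR : r < R) {φ : ℂ}
    (hφ : ‖φ‖ < ((R + k) / (k + r)) ^ n) {G : ℂ[X]} (hG : G.natDegree = n) (hG0 : G ≠ 0)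
    (hroot : ∀ z, G.IsRoot z → ‖z‖ ≤ k) {z : ℂ} (hz : 1 ≤ ‖z‖) :
    (rahmanOp n l₀ l₁ l₂ (dilate R G + C φ * dilate r G)).eval z ≠ 0 := by
  refine rahmanOp_eval_ne_zero hn hU ?_ ?_ hz
  · refine natDegree_eq_of_le_of_coeff_ne_zero ?_ ?_
    · refine (natDegree_add_le _ _).trans (max_le ?_ ((natDegree_C_mul_le _ _).trans ?_))
      all_goals exact (natDegree_dilate_le _ _).trans hG.le
    · rw [coeff_add, coeff_C_mul, coeff_dilate, coeff_dilate]
      have h1 : G.coeff n ≠ 0 := by rw [← hG]; exact leadingCoeff_ne_zero.2 hG0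
      have := mul_ne_zero h1 (pow_add_mul_pow_ne_zero hn hk hr hR hφ.le)
      convert this using 1; ring
  · intro w hw e
    rw [eval_add, eval_mul, eval_C, eval_dilate, eval_dilate] at e
    have h1 := norm_eval_growth hk hr hR hG hroot hw
    rw [eq_neg_of_add_eq_zero_left e, norm_neg, norm_mul] at h1
    -- When `r = k`, the point `rw` may lie on the circle where `G` can vanish; but then `e` would
    -- make `G(Rw)` vanish too, although `|Rw| > k`.
    have h2 : 0 < ‖G.eval (r * w)‖ := by
      rw [norm_pos_iff]
      intro h0
      have hne : G.eval (R * w) ≠ 0 := fun h => by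
        have := hroot _ h
        rw [norm_mul, Complex.norm_real, Real.norm_of_nonneg (by linarith)] at this
        nlinarith
      rw [h0, mul_zero, add_zero] at e
      exact hne e
    nlinarith

lemma norm_rahmanOp_dilate_le_of_lt {n : ℕ} (hn : 1 ≤ n) {l₀ l₁ l₂ : ℂ}
    (hU : ∀ z : ℂ, (rahmanU n l₀ l₁ l₂).IsRoot z → ‖z‖ ≤ ‖z - (n : ℂ) / 2‖)
    {k R r : ℝ} (hk : 0 < k) (hr : k ≤ r) (hR : r < R) {φ : ℂ}
    (hφ : ‖φ‖ < ((R + k) / (k + r)) ^ n) {F P : ℂ[X]} (hF : F.natDegree = n) (hF0 : F ≠ 0)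
    (hroot : ∀ z, F.IsRoot z → ‖z‖ ≤ k) (hP : P.natDegree ≤ n)
    (h : ∀ z : ℂ, ‖z‖ = k → ‖P.eval z‖ ≤ ‖F.eval z‖) {z : ℂ} (hz : 1 ≤ ‖z‖) :
    ‖(rahmanOp n l₀ l₁ l₂ (dilate R P + C φ * dilate r P)).eval z‖ ≤
      ‖(rahmanOp n l₀ l₁ l₂ (dilate R F + C φ * dilate r F)).eval z‖ := by
  set T : ℂ[X] → ℂ := fun Q => (rahmanOp n l₀ l₁ l₂ (dilate R Q + C φ * dilate r Q)).eval z
    with hT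
  change ‖T P‖ ≤ ‖T F‖
  have hTF : T F ≠ 0 := rahmanOp_dilate_eval_ne_zero hn hU hk hr hR hφ hF hF0 hroot hz
  by_contra! hlt
  have hlam : 1 < ‖T P / T F‖ := by
    rwa [norm_div, one_lt_div (norm_pos_iff.2 hTF)]
  obtain ⟨g1, g2, g3⟩ := sub_C_mul_of_norm_le hk hF hF0 hroot hP h hlam
  refine rahmanOp_dilate_eval_ne_zero hn hU hk hr hR hφ g1 g2 g3 hz ?_
  have : ∀ c : ℂ, T (P - C c * F) = T P - c * T F := by
    intro c
    have e : dilate R (P - C c * F) + C φ * dilate r (P - C c * F) =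
        (dilate R P + C φ * dilate r P) + C (-c) * (dilate R F + C φ * dilate r F) := by
      simp only [dilate, sub_comp, mul_comp, C_comp, C_neg]; ring
    simp only [hT]
    rw [e, rahmanOp_add, rahmanOp_C_mul, eval_add, eval_mul, eval_C]; ring
  change T _ = 0
  rw [this, div_mul_cancel₀ _ hTF, sub_self]

lemma rahmanExpr_eq {n : ℕ} {l₀ l₁ l₂ : ℂ} {B : ℂ[X] → ℂ[X]}
    (hB : ∀ P : ℂ[X], P.degree ≤ n → B P = rahmanOp n l₀ l₁ l₂ P) (k R r : ℝ) (α β : ℂ)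
    {P : ℂ[X]} (hP : P.degree ≤ n) (z : ℂ) :
    rahmanExpr n B k R r α β P z = (rahmanOp n l₀ l₁ l₂
      (dilate R P + C (rahmanPhi n k R r α β) * dilate r P)).eval z := by
  have h : ∀ s, (dilate s P).degree ≤ n := fun s =>
    natDegree_le_iff_degree_le.1 ((natDegree_dilate_le s P).trans (natDegree_le_iff_degree_le.2 hP))
  rw [rahmanExpr, hB _ (h R), hB _ (h r), rahmanOp_add, rahmanOp_C_mul, eval_add, eval_mul, eval_C]

open Filter Topology in
lemma norm_rahmanExpr_le {n : ℕ} {k : ℝ} (hk : 0 < k) {B : ℂ[X] → ℂ[X]} (hB : B ∈ RahmanClass n)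
    {α β : ℂ} (hα : ‖α‖ ≤ 1) (hβ : ‖β‖ ≤ 1) {R r : ℝ} (hr : k ≤ r) (hR : r < R)
    {F P : ℂ[X]} (hFP : Dominates n k F P) {z : ℂ} (hz : 1 ≤ ‖z‖) :
    ‖rahmanExpr n B k R r α β P z‖ ≤ ‖rahmanExpr n B k R r α β F z‖ := by
  obtain ⟨l₀, l₁, l₂, hU, hB⟩ := hB
  obtain ⟨hF, hroot, hP, h⟩ := hFP
  rw [rahmanExpr_eq hB _ _ _ _ _ hP, rahmanExpr_eq hB _ _ _ _ _ hF.le]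
  have hP' : P.natDegree ≤ n := natDegree_le_iff_degree_le.2 hP
  have hF' : F.natDegree = n := natDegree_eq_of_degree_eq_some hF
  have hF0 : F ≠ 0 := by rintro rfl; simp at hF
  rcases Nat.eq_zero_or_pos n with rfl | hn
  -- For `n = 0` the growth factor is `1` and the strict bound on `Φ` can fail, but both polynomials
  -- are constants and scale one common value.
  · obtain ⟨a, rfl⟩ : ∃ a, P = C a := ⟨_, eq_C_of_natDegree_le_zero hP'⟩
    obtain ⟨b, rfl⟩ : ∃ b, F = C b := ⟨_, eq_C_of_natDegree_eq_zero hF'⟩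
    have hab : ‖a‖ ≤ ‖b‖ := by
      simpa using h k (by rw [Complex.norm_real, Real.norm_of_nonneg hk.le])
    have e : ∀ c : ℂ, dilate R (C c) + C (rahmanPhi 0 k R r α β) * dilate r (C c) =
        C c * (1 + C (rahmanPhi 0 k R r α β)) := fun c => by simp only [dilate, C_comp]; ring
    rw [e, e, rahmanOp_C_mul, rahmanOp_C_mul, eval_mul, eval_mul, eval_C, eval_C, norm_mul,
      norm_mul]
    gcongr
  -- Replace `β` by `tβ` with `0 < t < 1`, where the bound on `Φ` is strict, and let `t → 1`.
  · have hc : ∀ Q : ℂ[X], Tendsto (fun t : ℝ => ‖(rahmanOp n l₀ l₁ l₂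
        (dilate R Q + C (rahmanPhi n k R r α (t * β)) * dilate r Q)).eval z‖) (𝓝[<] 1)
        (𝓝 ‖(rahmanOp n l₀ l₁ l₂
        (dilate R Q + C (rahmanPhi n k R r α β) * dilate r Q)).eval z‖) := by
      intro Q
      simp only [rahmanOp_add, rahmanOp_C_mul, eval_add, eval_mul, eval_C, rahmanPhi]
      refine Tendsto.mono_left ?_ nhdsWithin_le_nhds
      refine ((Continuous.tendsto' ?_ _ _ ?_))
      · fun_prop
      · simp
    refine le_of_tendsto_of_tendsto (hc P) (hc F) ?_
    filter_upwards [Ioo_mem_nhdsLT (zero_lt_one' ℝ)] with t ht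
    refine norm_rahmanOp_dilate_le_of_lt hn hU hk hr hR (norm_rahmanPhi_lt hn hk hr hR hα ?_)
      hF' hF0 hroot hP' h hz
    rw [norm_mul, Complex.norm_real, Real.norm_of_nonneg ht.1.le]
    have := norm_nonneg β
    nlinarith [ht.1, ht.2]

/-! ### Equality and sharpness -/

lemma rahmanExpr_C_mul {n : ℕ} {k : ℝ} {B : ℂ[X] → ℂ[X]} (hB : B ∈ RahmanClass n)
    (α β : ℂ) (R r : ℝ) (c : ℂ) {F : ℂ[X]} (hF : F.degree ≤ n) (z : ℂ) :
    rahmanExpr n B k R r α β (C c * F) z = c * rahmanExpr n B k R r α β F z := by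
  obtain ⟨l₀, l₁, l₂, -, hB⟩ := hB
  have hcF : (C c * F).degree ≤ n := natDegree_le_iff_degree_le.1
    ((natDegree_C_mul_le _ _).trans (natDegree_le_iff_degree_le.2 hF))
  rw [rahmanExpr_eq hB _ _ _ _ _ hF, rahmanExpr_eq hB _ _ _ _ _ hcF]
  have e : dilate R (C c * F) + C (rahmanPhi n k R r α β) * dilate r (C c * F) =
      C c * (dilate R F + C (rahmanPhi n k R r α β) * dilate r F) := by
    simp only [dilate, mul_comp, C_comp]; ring
  rw [e, rahmanOp_C_mul, eval_mul, eval_C]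

lemma rahmanExpr_X_pow_ne_zero {n : ℕ} (hn : 1 ≤ n) {k : ℝ} (hk : 0 < k) {B : ℂ[X] → ℂ[X]}
    (hB : B ∈ RahmanClass n) {α β : ℂ} (hα : ‖α‖ ≤ 1) (hβ : ‖β‖ ≤ 1) {R r : ℝ} (hr : k ≤ r)
    (hR : r < R) {z : ℂ} (hz : 1 ≤ ‖z‖) : rahmanExpr n B k R r α β (X ^ n) z ≠ 0 := by
  obtain ⟨l₀, l₁, l₂, hU, hB⟩ := hB
  rw [rahmanExpr_eq hB _ _ _ _ _ (degree_X_pow n).le]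
  have e : dilate R (X ^ n) + C (rahmanPhi n k R r α β) * dilate r (X ^ n) =
      C ((R : ℂ) ^ n + rahmanPhi n k R r α β * (r : ℂ) ^ n) * X ^ n := by
    simp only [dilate, X_pow_comp, mul_pow, C_add, C_mul, C_pow]; ring
  rw [e, rahmanOp_C_mul, eval_mul, eval_C]
  refine mul_ne_zero
    (pow_add_mul_pow_ne_zero hn hk hr hR (norm_rahmanPhi_le hk hr hR hα hβ)) ?_
  refine rahmanOp_eval_ne_zero hn hU (natDegree_X_pow n) (fun w hw => ?_) hz
  rw [eval_pow, eval_X]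
  exact pow_ne_zero n (norm_pos_iff.1 (by linarith))

theorem theorem2p1 (n : ℕ) (k : ℝ) (hk : 0 < k)
    (B : ℂ[X] → ℂ[X]) (hB : B ∈ RahmanClass n)
    (α β : ℂ) (hα : ‖α‖ ≤ 1) (hβ : ‖β‖ ≤ 1)
    (R r : ℝ) (hr : k ≤ r) (hR : r < R) :
    -- the inequality
    (∀ F P : ℂ[X], Dominates n k F P → ∀ z : ℂ, 1 ≤ ‖z‖ →
      ‖rahmanExpr n B k R r α β P z‖ ≤ ‖rahmanExpr n B k R r α β F z‖) ∧
    -- the polynomials `e^{iγ} F` are admissible and give equality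
    (∀ F : ℂ[X], F.degree = n → (∀ z : ℂ, F.IsRoot z → ‖z‖ ≤ k) → ∀ γ : ℝ,
      Dominates n k F (C (Complex.exp (Complex.I * γ)) * F) ∧
      ∀ z : ℂ, 1 ≤ ‖z‖ →
        ‖rahmanExpr n B k R r α β (C (Complex.exp (Complex.I * γ)) * F) z‖
          = ‖rahmanExpr n B k R r α β F z‖) ∧
    -- the result is best possible: the constant 1 cannot be lowered, at any point `z`
    (1 ≤ n → ∀ z : ℂ, 1 ≤ ‖z‖ → ∀ c : ℝ,
      (∀ F P : ℂ[X], Dominates n k F P →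
        ‖rahmanExpr n B k R r α β P z‖ ≤ c * ‖rahmanExpr n B k R r α β F z‖) → 1 ≤ c) := by
  refine ⟨fun F P h z hz => norm_rahmanExpr_le hk hB hα hβ hr hR h hz,
    fun F hF hroot γ => ⟨⟨hF, hroot, ?_, fun z _ => ?_⟩, fun z _ => ?_⟩, fun hn z hz c hc => ?_⟩
  · rw [degree_C_mul (Complex.exp_ne_zero _), hF]
  · rw [eval_mul, eval_C, norm_mul, mul_comm Complex.I, Complex.norm_exp_ofReal_mul_I, one_mul]
  · rw [rahmanExpr_C_mul hB _ _ _ _ _ hF.le, norm_mul, mul_comm Complex.I,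
      Complex.norm_exp_ofReal_mul_I, one_mul]
  -- Equality at `P = F = X ^ n` forces `c ≥ 1` because the common value is nonzero. For `n = 0` it
  -- can vanish, for instance when `α = 1`, where `Φ = -1`.
  · have h1 := hc (X ^ n) (X ^ n) ⟨degree_X_pow n, fun w hw => ?_, (degree_X_pow n).le,
      fun _ _ => le_rfl⟩
    · have h2 := norm_pos_iff.2 (rahmanExpr_X_pow_ne_zero hn hk hB hα hβ hr hR hz)
      exact le_of_mul_le_mul_right (by rwa [one_mul]) h2
    · rw [IsRoot.def, eval_pow, eval_X] at hw
      rw [eq_zero_of_pow_eq_zero hw, norm_zero]; exact hk.le
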